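/- All graphs are finite and simple. For a graph $G$, let $\chi(G)$ be its chromatic number and let $c(G)$ be the number of cycles (of any length) in $G$, counted as subgraphs. An edge $e$ of a graph $H$ is called critical if $\chi(H\setminus\{e\})=\chi(H)-1$, where $H\setminus\{e\}$ is $H$ with the edge $e$ deleted. A graph is $H$-free if it has no (not necessarily induced) subgraph isomorphic to $H$. Let $T_k(n)$ denote the Turán graph, i.e. the complete $k$-partite graph on $n$ vertices with all classes of size $\lfloor n/k\rfloor$ or $\lceil n/k\rceil$. **Lemma 4.1.** Let $k\ge 2$ and let $H$ be a graph with $\chi(H)=k+1$ containing a critical edge. Then there are constants $C$ and $n_0$, depending only on $H$, such that for every $n\ge n_0$, every $n$-vertex $H$-free graph $G$ with $c(G)\ge c(T_k(n))$ has at least $$\frac{(k-1)\,n^2}{2k}-C\,n\log^2 n$$ edges, where $\log^2 n=(\log n)^2$. -/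

import Mathlib

namespace SimpleGraph

universe u

/-- The number `c(G)` of cycles of `G`, of any length. A cycle is counted as a subgraph of `G`, so
neither its starting vertex nor its orientation matters. -/
noncomputable def cycleCount {V : Type u} (G : SimpleGraph V) : ℕ :=
  {C : G.Subgraph | ∃ (v : V) (p : G.Walk v v), p.IsCycle ∧ p.toSubgraph = C}.ncard

/-- An edge `e` of `H` is critical if deleting it, while keeping all the vertices, lowers the
chromatic number by exactly one. -/
def IsCriticalEdge {W : Type u} (H : SimpleGraph W) (e : Sym2 W) : Prop :=
  e ∈ H.edgeSet ∧ (H.deleteEdges {e}).chromaticNumber + 1 = H.chromaticNumber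

end SimpleGraph

/-! Put `D = (k - 1) n / k`, essentially the degree in the Turán graph. Both cycle counts are
compared on the logarithmic scale, where the main term is `n log D - n` and the errors are `O(log
n)`.

Upper bound: rotating along a cycle and fixing the other vertices gives a permutation sending each
vertex into its closed neighbourhood. Distinct cycles give distinct permutations, so Brègman's
inequality (`log_card_perm_le`) bounds `log c(G)` by a sum over the degrees. The tangent line at `D`
(`Real.log_factorial_div_le`) makes that sum linear in the degrees, hence in the number of edges
(`log_cycleCount_le_of_card`).

Lower bound: cycles of the Turán graph are built from balanced proper cyclic colour patterns. Words
with equal letter counts and equal ends are placed in `2k` blocks, shifted by the block index to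
balance the colours and alternately reversed so that the joints are proper. Filling each colour with
vertices of its class gives `le_cycleCount_turanGraph`, and Stirling gives
`le_log_cycleCount_turanGraph`.

Since `c(G)` is at least the Turán count, the term `2 e(G) / D` must make up `n` up to `O(log n)`,
which forces the edge bound. -/

/-! ### Brègman's inequality by random orderings -/

/-- Choosing distinct images one at a time, uniformly among the available ones, gives a
sub-probability distribution. -/
theorem sum_prod_inv_card_available_le_one {α : Type*} [Fintype α] [DecidableEq α] :
    ∀ (m : ℕ) (S : Fin m → Finset α),
      ∑ p : Fin m → α, ∏ i, (if p i ∈ S i \ (Finset.Iio i).image p then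
        ((S i \ (Finset.Iio i).image p).card : ℝ)⁻¹ else 0) ≤ 1 := by
  intro m
  induction m with
  | zero => intro S; simp
  | succ m ih =>
    intro S
    -- Given the earlier choices, the weights of the last choice sum to `1`, or to `0` when no image
    -- is left.
    rw [← (Fin.snocEquiv (fun _ => α)).sum_comp, Fintype.sum_prod_type_right]
    refine le_trans (Finset.sum_le_sum fun p _ => ?_) (ih fun i => S i.castSucc)
    have himg : ∀ (a : α) (i : Fin m),
        (Finset.Iio i.castSucc).image (Fin.snoc p a : Fin (m + 1) → α) = (Finset.Iio i).image p := by
      intro a i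
      ext x
      simp only [Finset.mem_image, Finset.mem_Iio]
      constructor
      · rintro ⟨j, hj, rfl⟩
        obtain ⟨j, rfl⟩ := Fin.exists_castSucc_eq.2 (ne_of_lt (lt_of_lt_of_le hj (Fin.le_last _)))
        exact ⟨j, by simpa using hj, by simp⟩
      · rintro ⟨j, hj, rfl⟩
        exact ⟨j.castSucc, by simpa using hj, by simp⟩
    have hlast : ∀ a : α, (Finset.Iio (Fin.last m)).image (Fin.snoc p a : Fin (m + 1) → α)
        = Finset.univ.image p := by
      intro a
      ext x
      simp only [Finset.mem_image, Finset.mem_Iio, Finset.mem_univ, true_and]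
      constructor
      · rintro ⟨j, hj, rfl⟩
        obtain ⟨j, rfl⟩ := Fin.exists_castSucc_eq.2 (ne_of_lt hj)
        exact ⟨j, by simp⟩
      · rintro ⟨j, rfl⟩
        exact ⟨j.castSucc, Fin.castSucc_lt_last j, by simp⟩
    simp only [Fin.snocEquiv, Equiv.coe_fn_mk, Fin.prod_univ_castSucc, Fin.snoc_castSucc,
      Fin.snoc_last, himg, hlast]
    rw [← Finset.mul_sum]
    refine mul_le_of_le_one_right (Finset.prod_nonneg fun i _ => by positivity) ?_
    rw [← Finset.sum_filter, Finset.sum_const, nsmul_eq_mul, Finset.filter_univ_mem]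
    exact mul_inv_le_one

/-- The sequential-choice bound for permutations, rows being processed in the order `τ`. -/
theorem sum_perm_prod_inv_card_le_one {V : Type*} [Fintype V] [DecidableEq V]
    (S : V → Finset V) {n : ℕ} (τ : V ≃ Fin n) :
    ∑ σ : Equiv.Perm V with ∀ v, σ v ∈ S v,
      ∏ v, (({u | σ u ∈ S v ∧ τ v ≤ τ u} : Finset V).card : ℝ)⁻¹ ≤ 1 := by
  refine le_trans ?_ (sum_prod_inv_card_available_le_one n fun i => S (τ.symm i))
  -- The images still available to `v` are the `σ u` in `S v` with `u` not processed before `v`.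
  have key : ∀ σ ∈ ({σ | ∀ v, σ v ∈ S v} : Finset (Equiv.Perm V)),
      ∏ v, (({u | σ u ∈ S v ∧ τ v ≤ τ u} : Finset V).card : ℝ)⁻¹ =
      ∏ i, (if (σ ∘ τ.symm) i ∈ S (τ.symm i) \ (Finset.Iio i).image (σ ∘ τ.symm) then
        ((S (τ.symm i) \ (Finset.Iio i).image (σ ∘ τ.symm)).card : ℝ)⁻¹ else 0) := by
    intro σ hσ
    simp only [Finset.mem_filter, Finset.mem_univ, true_and] at hσ
    rw [← τ.symm.prod_comp]
    refine Finset.prod_congr rfl fun i _ => ?_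
    have hmem : (σ ∘ τ.symm) i ∈ S (τ.symm i) \ (Finset.Iio i).image (σ ∘ τ.symm) := by
      simp [hσ]
    rw [if_pos hmem]
    congr 2
    refine Finset.card_bij (fun u _ => σ u) ?_ (fun _ _ _ _ h => σ.injective h) ?_
    · intro u hu
      simp only [Finset.mem_filter, Finset.mem_univ, true_and, Equiv.apply_symm_apply] at hu
      simp only [Finset.mem_sdiff, hu.1, Finset.mem_image, Finset.mem_Iio, Function.comp,
        EmbeddingLike.apply_eq_iff_eq, true_and, not_exists, not_and]
      rintro j hj rfl
      simp only [Equiv.apply_symm_apply] at hu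
      exact absurd hj (not_lt.2 hu.2)
    · intro b hb
      refine ⟨σ.symm b, ?_, by simp⟩
      simp only [Finset.mem_sdiff, Finset.mem_image, Finset.mem_Iio, Function.comp, not_exists,
        not_and] at hb
      simp only [Finset.mem_filter, Finset.mem_univ, true_and, Equiv.apply_symm_apply, hb.1]
      by_contra! hlt
      exact hb.2 _ hlt (by simp)
  rw [Finset.sum_congr rfl key, ← Finset.sum_image (s := {σ | ∀ v, σ v ∈ S v})
    (g := fun σ : Equiv.Perm V => (σ ∘ τ.symm : Fin n → V))
    (f := fun p : Fin n → V => ∏ i, (if p i ∈ S (τ.symm i) \ (Finset.Iio i).image p then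
        ((S (τ.symm i) \ (Finset.Iio i).image p).card : ℝ)⁻¹ else 0))]
  · exact Finset.sum_le_sum_of_subset_of_nonneg (Finset.subset_univ _)
      fun p _ _ => Finset.prod_nonneg fun i _ => by positivity
  · intro σ _ σ' _ h
    ext v
    simpa using congrFun h (τ v)

/-- The ranks from the top of the elements of `T` are `1, …, |T|`. -/
theorem sum_rank_eq {V ι : Type*} [LinearOrder ι] (T : Finset V) (τ : V → ι)
    (hτ : Function.Injective τ) (f : ℕ → ℝ) :
    ∑ s ∈ T, f (T.filter fun u => τ s ≤ τ u).card = ∑ j ∈ Finset.range T.card, f (j + 1) := by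
  have hinj : Set.InjOn (fun s => (T.filter fun u => τ s ≤ τ u).card - 1) T := by
    have aux : ∀ a ∈ T, ∀ b ∈ T, τ a < τ b →
        (T.filter fun u => τ b ≤ τ u).card < (T.filter fun u => τ a ≤ τ u).card := by
      intro a ha b hb hab
      refine Finset.card_lt_card ⟨fun u hu => ?_, fun h => ?_⟩
      · simp only [Finset.mem_filter] at hu ⊢
        exact ⟨hu.1, hab.le.trans hu.2⟩
      · have := h (Finset.mem_filter.2 ⟨ha, le_rfl⟩)
        exact absurd (Finset.mem_filter.1 this).2 (not_le.2 hab)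
    intro a ha b hb hab
    have hpos : ∀ s ∈ T, 0 < (T.filter fun u => τ s ≤ τ u).card := fun s hs =>
      Finset.card_pos.2 ⟨s, Finset.mem_filter.2 ⟨hs, le_rfl⟩⟩
    have h1 := hpos a ha
    have h2 := hpos b hb
    simp only at hab
    rcases lt_trichotomy (τ a) (τ b) with h | h | h
    · have := aux a ha b hb h; omega
    · exact hτ h
    · have := aux b hb a ha h; omega
  have hpos : ∀ s ∈ T, 0 < (T.filter fun u => τ s ≤ τ u).card := fun s hs =>
    Finset.card_pos.2 ⟨s, Finset.mem_filter.2 ⟨hs, le_rfl⟩⟩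
  have hmaps : Set.MapsTo (fun s => (T.filter fun u => τ s ≤ τ u).card - 1) T
      (Finset.range T.card) := by
    intro s hs
    have h1 := hpos s hs
    have h2 := Finset.card_filter_le T fun u => τ s ≤ τ u
    simp only [Finset.coe_range, Set.mem_Iio]
    omega
  refine Finset.sum_nbij (fun s => (T.filter fun u => τ s ≤ τ u).card - 1) hmaps hinj ?_ ?_
  · exact Finset.surjOn_of_injOn_of_card_le _ hmaps hinj (by simp)
  · intro s hs
    rw [Nat.sub_add_cancel (hpos s hs)]

/-- Over all orderings, the rank of a fixed element of `T` is uniform on `1, …, |T|`. -/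
theorem card_mul_sum_orderings_rank {V : Type*} [Fintype V] [DecidableEq V] {n : ℕ}
    (T : Finset V) {v : V} (hv : v ∈ T) (f : ℕ → ℝ) :
    (T.card : ℝ) * ∑ τ : V ≃ Fin n, f (T.filter fun u => τ v ≤ τ u).card =
      Fintype.card (V ≃ Fin n) * ∑ j ∈ Finset.range T.card, f (j + 1) := by
  -- Precomposing the orderings with the transposition of `v` and `s` preserves `T` and exchanges
  -- their ranks.
  have hsymm : ∀ s ∈ T, ∑ τ : V ≃ Fin n, f (T.filter fun u => τ s ≤ τ u).card =
      ∑ τ : V ≃ Fin n, f (T.filter fun u => τ v ≤ τ u).card := by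
    intro s hs
    refine Fintype.sum_equiv ((Equiv.swap v s).equivCongr (Equiv.refl _)) _ _ fun τ => ?_
    have hmem : ∀ u ∈ T, Equiv.swap v s u ∈ T := by
      intro u hu
      rw [Equiv.swap_apply_def]
      split_ifs <;> assumption
    congr 1
    refine Finset.card_bij (fun u _ => Equiv.swap v s u) ?_
      (fun _ _ _ _ h => (Equiv.swap v s).injective h) ?_
    · intro u hu
      simp only [Finset.mem_filter] at hu ⊢
      exact ⟨hmem u hu.1, by simpa [Equiv.equivCongr] using hu.2⟩
    · intro u hu
      simp only [Finset.mem_filter] at hu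
      refine ⟨Equiv.swap v s u, ?_, by simp⟩
      simp only [Finset.mem_filter]
      exact ⟨hmem u hu.1, by simpa [Equiv.equivCongr] using hu.2⟩
  rw [← nsmul_eq_mul, ← Finset.sum_const, ← Finset.sum_congr rfl hsymm, Finset.sum_comm,
    Finset.sum_congr rfl fun (τ : V ≃ Fin n) _ => sum_rank_eq T τ τ.injective f]
  simp

/-- **Brègman's inequality**, in logarithmic form. -/
theorem log_card_perm_le {V : Type*} [Fintype V] [DecidableEq V] (S : V → Finset V)
    (hS : ∀ v, v ∈ S v) :
    Real.log (({σ | ∀ v, σ v ∈ S v} : Finset (Equiv.Perm V)).card) ≤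
      ∑ v, Real.log ((S v).card.factorial) / (S v).card := by
  set P : Finset (Equiv.Perm V) := {σ | ∀ v, σ v ∈ S v} with hP
  set B := ∑ v, Real.log ((S v).card.factorial) / (S v).card with hB
  set n := Fintype.card V
  let N : Equiv.Perm V → (V ≃ Fin n) → V → ℕ := fun σ τ v =>
    ({u | σ u ∈ S v ∧ τ v ≤ τ u} : Finset V).card
  obtain ⟨t, ht⟩ : ∃ t : ℝ, t = ((Fintype.card (V ≃ Fin n) : ℕ) : ℝ) := ⟨_, rfl⟩
  have htpos : 0 < t := by
    rw [ht, Nat.cast_pos, Fintype.card_pos_iff]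
    exact ⟨Fintype.equivFin V⟩
  have hlogfac : ∀ d : ℕ, ∑ j ∈ Finset.range d, Real.log ((j + 1 : ℕ) : ℝ)
      = Real.log (d.factorial) := by
    intro d
    rw [← Finset.prod_range_add_one_eq_factorial, Nat.cast_prod,
      Real.log_prod (fun i _ => by positivity)]
  -- `N σ τ v` is the rank of `v` in the preimage of `S v` under `σ`, which is uniform over random
  -- `τ`.
  have hrow : ∀ σ ∈ P, ∀ v, ∑ τ : V ≃ Fin n, Real.log (N σ τ v) =
      t * (Real.log ((S v).card.factorial) / (S v).card) := by
    intro σ hσ v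
    have hσ' : ∀ v, σ v ∈ S v := by simpa [hP] using hσ
    set T : Finset V := {u | σ u ∈ S v} with hT
    have hvT : v ∈ T := by simp [hT, hσ' v]
    have hcard : T.card = (S v).card := by
      refine Finset.card_bij (fun u _ => σ u) (by simp [hT]) (fun _ _ _ _ h => σ.injective h) ?_
      intro b hb
      exact ⟨σ.symm b, by simp [hT, hb], by simp⟩
    have hN : ∀ τ : V ≃ Fin n, N σ τ v = (T.filter fun u => τ v ≤ τ u).card := by
      intro τ
      simp only [N, hT, Finset.filter_filter]
    have h := card_mul_sum_orderings_rank (n := n) T hvT (fun x => Real.log (x : ℝ))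
    rw [hlogfac, hcard] at h
    have hpos : (0 : ℝ) < (S v).card := by
      rw [Nat.cast_pos]; exact Finset.card_pos.2 ⟨v, hS v⟩
    simp only [hN]
    rw [mul_div_assoc', eq_div_iff hpos.ne', mul_comm, h, ht]
  -- Jensen for `exp`: the average weight of `σ` is at least `exp` of its average logarithm, which
  -- is `-B`.
  have hjensen : ∀ σ ∈ P, t * Real.exp (-B) ≤
      ∑ τ : V ≃ Fin n, ∏ v, ((N σ τ v : ℕ) : ℝ)⁻¹ := by
    intro σ hσ
    have hσ' : ∀ v, σ v ∈ S v := by simpa [hP] using hσ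
    have hNpos : ∀ τ v, (0 : ℝ) < N σ τ v := by
      intro τ v
      rw [Nat.cast_pos]
      exact Finset.card_pos.2 ⟨v, by simp [hσ' v]⟩
    have h := convexOn_exp.map_sum_le (t := (Finset.univ : Finset (V ≃ Fin n)))
      (w := fun _ => t⁻¹) (p := fun τ => -∑ v, Real.log (N σ τ v)) (fun _ _ => by positivity)
      (by simp [← ht, htpos.ne']) (fun _ _ => Set.mem_univ _)
    have h1 : ∑ τ : V ≃ Fin n, t⁻¹ • -∑ v, Real.log (N σ τ v) = -B := by
      simp only [smul_eq_mul]
      rw [← Finset.mul_sum, Finset.sum_neg_distrib, Finset.sum_comm,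
        Finset.sum_congr rfl fun v _ => hrow σ hσ v, ← Finset.mul_sum, ← hB]
      field_simp
    rw [h1] at h
    simp only [smul_eq_mul] at h
    rw [← Finset.mul_sum] at h
    have h2 : ∀ τ : V ≃ Fin n, Real.exp (-∑ v, Real.log (N σ τ v)) =
        ∏ v, ((N σ τ v : ℕ) : ℝ)⁻¹ := by
      intro τ
      rw [← Finset.sum_neg_distrib, Real.exp_sum]
      refine Finset.prod_congr rfl fun v _ => ?_
      rw [Real.exp_neg, Real.exp_log (hNpos τ v)]
    rw [Finset.sum_congr rfl fun τ _ => h2 τ] at h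
    rwa [← div_eq_inv_mul, le_div_iff₀' htpos] at h
  have hsum : P.card * (t * Real.exp (-B)) ≤ t := by
    rw [← nsmul_eq_mul]
    refine (Finset.card_nsmul_le_sum _ _ _ hjensen).trans ?_
    rw [Finset.sum_comm]
    refine (Finset.sum_le_sum fun τ _ => sum_perm_prod_inv_card_le_one S τ).trans ?_
    simp [ht]
  have hPpos : (0 : ℝ) < P.card := by
    rw [Nat.cast_pos]
    exact Finset.card_pos.2 ⟨1, by simp [hP, hS]⟩
  rw [Real.log_le_iff_le_exp hPpos]
  have h3 : P.card * Real.exp (-B) ≤ 1 := by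
    have : t * (P.card * Real.exp (-B)) ≤ t * 1 := by linarith
    exact le_of_mul_le_mul_left this htpos
  rwa [Real.exp_neg, ← div_eq_mul_inv, div_le_one (Real.exp_pos _)] at h3

/-! ### Cycles as permutations -/

namespace SimpleGraph

/-- A cycle is encoded by the permutation that moves each of its vertices one step along it. -/
theorem Walk.IsCycle.exists_perm {V : Type*} [DecidableEq V] {G : SimpleGraph V} {v : V}
    {p : G.Walk v v} (hp : p.IsCycle) :
    ∃ σ : Equiv.Perm V, (∀ x, σ x = x ∨ G.Adj x (σ x)) ∧
      ∀ x y, p.toSubgraph.Adj x y ↔ x ≠ y ∧ (σ x = y ∨ σ y = x) := by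
  -- The tail drops the repeated base vertex, which remains as the last entry; hence the shifted
  -- indices below.
  set l := p.support.tail with hl
  have hnd : l.Nodup := hp.support_nodup
  have hlen : l.length = p.length := by simp [hl]
  have h3 := hp.three_le_length
  have hget : ∀ i (hi : i < l.length), l[i] = p.getVert (i + 1) := by
    intro i hi
    simp only [hl, List.getElem_tail]
    rw [Walk.getVert_eq_support_getElem _ (by omega)]
  have hstep : ∀ i < p.length, l.formPerm (p.getVert i) = p.getVert (i + 1) := by
    intro i hi
    rcases Nat.eq_zero_or_pos i with rfl | hpos
    · have h0 : p.getVert 0 = l[p.length - 1]'(by omega) := by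
        rw [hget, Nat.sub_add_cancel (by omega)]; simp
      rw [h0, List.formPerm_apply_getElem _ hnd, ← hget 0 (by omega)]
      congr 1
      rw [hlen, Nat.sub_add_cancel (by omega), Nat.mod_self]
    · have h0 : p.getVert i = l[i - 1]'(by omega) := by
        rw [hget, Nat.sub_add_cancel (by omega)]
      rw [h0, List.formPerm_apply_getElem _ hnd, ← hget i (by omega)]
      congr 1
      rw [hlen, Nat.sub_add_cancel (by omega), Nat.mod_eq_of_lt hi]
  have hmoved : ∀ x, l.formPerm x ≠ x → p.toSubgraph.Adj x (l.formPerm x) := by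
    intro x hx
    have hxl := List.mem_of_formPerm_apply_ne hx
    obtain ⟨i, hi, rfl⟩ := List.getElem_of_mem hxl
    rw [hget]
    rcases (by omega : i + 1 < p.length ∨ i + 1 = p.length) with h | h
    · rw [hstep _ h]
      exact p.toSubgraph_adj_getVert h
    · have h0 : p.getVert (i + 1) = p.getVert 0 := by simp [h]
      rw [h0, hstep 0 (by omega)]
      exact p.toSubgraph_adj_getVert (by omega)
  refine ⟨l.formPerm, fun x => ?_, fun x y => ⟨fun h => ⟨h.ne, ?_⟩, ?_⟩⟩
  · by_cases h : l.formPerm x = x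
    · exact Or.inl h
    · exact Or.inr (hmoved x h).adj_sub
  · obtain ⟨i, hi, hlt⟩ := p.toSubgraph_adj_iff.1 h
    rcases Sym2.eq_iff.1 hi with ⟨rfl, rfl⟩ | ⟨rfl, rfl⟩
    · exact Or.inl (hstep i hlt)
    · exact Or.inr (hstep i hlt)
  · rintro ⟨hne, rfl | rfl⟩
    · exact hmoved x hne.symm
    · exact (hmoved y hne).symm

/-- No vertex of a cycle is isolated in it, so a cycle can be recovered from its edges alone. -/
theorem Walk.IsCycle.verts_toSubgraph_eq {V : Type*} {G : SimpleGraph V} {v : V}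
    {p : G.Walk v v} (hp : p.IsCycle) :
    p.toSubgraph.verts = {x | ∃ y, p.toSubgraph.Adj x y} := by
  ext x
  refine ⟨fun hx => ?_, fun ⟨y, hy⟩ => p.toSubgraph.edge_vert hy⟩
  have h2 := hp.ncard_neighborSet_toSubgraph_eq_two ((p.mem_verts_toSubgraph).1 hx)
  exact Set.nonempty_of_ncard_ne_zero (s := p.toSubgraph.neighborSet x) (by rw [h2]; norm_num)

/-- Distinct cycles are encoded by distinct permutations each of whose points is fixed or moved to
a neighbour. -/
theorem cycleCount_le_card_perm {V : Type*} [Fintype V] [DecidableEq V] (G : SimpleGraph V)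
    [DecidableRel G.Adj] :
    G.cycleCount ≤
      ({σ | ∀ v, σ v ∈ insert v (G.neighborFinset v)} : Finset (Equiv.Perm V)).card := by
  classical
  have hex : ∀ C : G.Subgraph, (∃ (v : V) (p : G.Walk v v), p.IsCycle ∧ p.toSubgraph = C) →
      ∃ σ : Equiv.Perm V, (∀ x, σ x = x ∨ G.Adj x (σ x)) ∧
        ∀ x y, C.Adj x y ↔ x ≠ y ∧ (σ x = y ∨ σ y = x) := by
    rintro C ⟨v, p, hp, rfl⟩
    exact hp.exists_perm
  choose! F hF using hex
  rw [← Set.ncard_coe_finset]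
  refine Set.ncard_le_ncard_of_injOn F (fun C hC => ?_) (fun C hC C' hC' h => ?_) (Set.toFinite _)
  · simpa using (hF C hC).1
  · have hadj : C.Adj = C'.Adj := by
      ext x y
      rw [(hF C hC).2, (hF C' hC').2, h]
    refine Subgraph.ext ?_ hadj
    obtain ⟨v, p, hp, rfl⟩ := hC
    obtain ⟨v', p', hp', rfl⟩ := hC'
    rw [hp.verts_toSubgraph_eq, hp'.verts_toSubgraph_eq, hadj]

/-- An upper bound for the number of cycles in terms of the degrees. -/
theorem log_cycleCount_le {V : Type*} [Fintype V] (G : SimpleGraph V) [DecidableRel G.Adj] :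
    Real.log G.cycleCount ≤
      ∑ v, Real.log ((G.degree v + 1).factorial) / (G.degree v + 1 : ℕ) := by
  classical
  have hcard : ∀ v, (insert v (G.neighborFinset v)).card = G.degree v + 1 := fun v => by
    rw [Finset.card_insert_of_notMem (by simp), card_neighborFinset_eq_degree]
  have h := log_card_perm_le (fun v => insert v (G.neighborFinset v)) (fun v => by simp)
  simp only [hcard] at h
  rcases Nat.eq_zero_or_pos G.cycleCount with h0 | h0
  · rw [h0, Nat.cast_zero, Real.log_zero]
    exact Finset.sum_nonneg fun v _ => div_nonneg (Real.log_natCast_nonneg _) (Nat.cast_nonneg _)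
  · refine le_trans (Real.log_le_log (by exact_mod_cast h0) ?_) h
    exact_mod_cast G.cycleCount_le_card_perm

end SimpleGraph

/-! ### Cycles as cyclic sequences -/

namespace SimpleGraph

/-- An injective cyclic sequence of adjacent vertices traces a cycle with exactly the expected
edges. -/
theorem exists_isCycle_of_cyclic {V : Type*} {G : SimpleGraph V} {n : ℕ} {f : Fin (n + 3) → V}
    (hf : Function.Injective f) (hadj : ∀ i, G.Adj (f i) (f (i + 1))) :
    ∃ (v : V) (p : G.Walk v v), p.IsCycle ∧
      ∀ x y, p.toSubgraph.Adj x y ↔ ∃ i, s(f i, f (i + 1)) = s(x, y) := by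
  have key : ∀ u v, (cycleGraph (n + 3)).Adj u v ↔ u = v + 1 ∨ v = u + 1 := by
    intro u v
    rw [cycleGraph_adj, sub_eq_iff_eq_add', sub_eq_iff_eq_add']
  let φ : cycleGraph (n + 3) →g G := ⟨f, by
    intro u v h
    rcases (key u v).1 h with rfl | rfl
    · exact (hadj _).symm
    · exact hadj _⟩
  have hφ : ∀ i, φ i = f i := fun _ => rfl
  refine ⟨_, (cycleGraph.cycle n).map φ,
    (Walk.isCycle_map_iff_of_injective hf).2 cycleGraph.isCycle_cycle, fun x y => ?_⟩
  have hall : ∀ i : Fin (n + 3), (cycleGraph.cycle n).toSubgraph.Adj i (i + 1) := by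
    intro i
    -- The standard cycle walks downwards, so it goes from `i + 1` to `i` at step `n + 2 - i`.
    have h := (cycleGraph.cycle n).toSubgraph_adj_getVert (i := n + 2 - i)
      (by rw [cycleGraph.length_cycle]; omega)
    rw [cycleGraph.getVert_cycle (by omega), cycleGraph.getVert_cycle (by omega)] at h
    convert h.symm using 1
    · ext
      have : n + 3 - (n + 2 - i + 1) = i := by omega
      simp [this, Nat.mod_eq_of_lt i.2]
    · ext
      have : n + 3 - (n + 2 - (i : ℕ)) = i + 1 := by omega
      simp [this, Fin.val_add]
  rw [Walk.toSubgraph_map, Subgraph.map_adj, Relation.map_apply]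
  constructor
  · rintro ⟨a, b, hab, rfl, rfl⟩
    rcases (key a b).1 hab.adj_sub with rfl | rfl
    · exact ⟨b, Sym2.eq_swap⟩
    · exact ⟨a, rfl⟩
  · rintro ⟨i, hi⟩
    rcases Sym2.eq_iff.1 hi with ⟨rfl, rfl⟩ | ⟨rfl, rfl⟩
    · exact ⟨i, i + 1, hall i, rfl, rfl⟩
    · exact ⟨i + 1, i, (hall i).symm, rfl, rfl⟩

/-- A cyclic sequence is determined by its edges and its first two terms. -/
theorem cyclic_eq_of_edges_eq {V : Type*} {n : ℕ} {f g : Fin (n + 3) → V}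
    (hf : Function.Injective f) (hg : Function.Injective g)
    (h : ∀ i, ∃ j, s(f j, f (j + 1)) = s(g i, g (i + 1))) (h0 : f 0 = g 0) (h1 : f 1 = g 1) :
    f = g := by
  have key : ∀ i : Fin (n + 3), f i = g i ∧ f (i + 1) = g (i + 1) := by
    intro i
    induction i using Fin.induction with
    | zero => simpa using ⟨h0, h1⟩
    | succ i ih =>
      rw [← Fin.coeSucc_eq_succ]
      generalize i.castSucc = c at ih
      refine ⟨ih.2, ?_⟩
      obtain ⟨j, hj⟩ := h (c + 1)
      rcases Sym2.eq_iff.1 hj with ⟨h2, h3⟩ | ⟨h2, h3⟩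
      · rw [← ih.2] at h2
        rw [← h3, hf h2]
      -- Turning back would give `g c = g (c + 2)`, impossible with at least three positions.
      · rw [← ih.2] at h3
        rw [add_right_cancel (hf h3), ih.1] at h2
        have h4 : c + 0 = c + (1 + 1) := by rw [add_zero, ← add_assoc]; exact hg h2
        have h5 := congrArg Fin.val (add_left_cancel h4)
        simp [Fin.val_add, Nat.mod_eq_of_lt] at h5
  funext i
  exact (key i).1

/-- Each cycle is traced by at most `n²` cyclic sequences. -/
theorem card_cyclic_le_cycleCount_mul {V : Type*} [Fintype V] (G : SimpleGraph V) {n : ℕ}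
    (A : Finset (Fin (n + 3) → V)) (hinj : ∀ f ∈ A, Function.Injective f)
    (hadj : ∀ f ∈ A, ∀ i, G.Adj (f i) (f (i + 1))) :
    A.card ≤ G.cycleCount * Fintype.card V ^ 2 := by
  classical
  have hex : ∀ f ∈ A, ∃ C : G.Subgraph,
      (∃ (v : V) (p : G.Walk v v), p.IsCycle ∧ p.toSubgraph = C) ∧
      ∀ x y, C.Adj x y ↔ ∃ i, s(f i, f (i + 1)) = s(x, y) := by
    intro f hf
    obtain ⟨v, p, hp, h⟩ := exists_isCycle_of_cyclic (hinj f hf) (hadj f hf)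
    exact ⟨_, ⟨v, p, hp, rfl⟩, h⟩
  have : Nonempty G.Subgraph := ⟨⊥⟩
  choose! F hF hFadj using hex
  set S := {C : G.Subgraph | ∃ (v : V) (p : G.Walk v v), p.IsCycle ∧ p.toSubgraph = C} with hS
  have hcard : G.cycleCount * Fintype.card V ^ 2 = (S ×ˢ (Set.univ : Set (V × V))).ncard := by
    rw [Set.ncard_prod, Set.ncard_univ, Nat.card_eq_fintype_card, Fintype.card_prod, sq]
    rfl
  rw [hcard, ← Set.ncard_coe_finset]
  refine Set.ncard_le_ncard_of_injOn (fun f => (F f, f 0, f 1)) (fun f hf => ?_)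
    (fun f hf g hg h => ?_) (Set.toFinite _)
  · exact ⟨hF f hf, Set.mem_univ _⟩
  · simp only [Prod.mk.injEq] at h
    refine cyclic_eq_of_edges_eq (hinj f hf) (hinj g hg) (fun i => ?_) h.2.1 h.2.2
    rw [← hFadj f hf, h.1, hFadj g hg]
    exact ⟨i, rfl⟩

end SimpleGraph

/-! ### Balanced colour patterns -/

/-- The number of injections respecting prescribed colours, when every colour is used exactly `m`
times and is available at least `m` times. -/
theorem factorial_pow_le_card_injective {X V κ : Type*} [Fintype X] [DecidableEq X] [Fintype V]
    [DecidableEq V] [Fintype κ] [DecidableEq κ] (col : V → κ) (m : ℕ)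
    (hcol : ∀ a, m ≤ ({v | col v = a} : Finset V).card) (c : X → κ)
    (hc : ∀ a, ({x | c x = a} : Finset X).card = m) :
    m.factorial ^ Fintype.card κ ≤
      Set.ncard {f : X → V | Function.Injective f ∧ col ∘ f = c} := by
  classical
  have hcard : m.factorial ^ Fintype.card κ ≤
      Fintype.card (∀ a : κ, ({x // c x = a} ↪ {v // col v = a})) := by
    rw [Fintype.card_pi, ← Finset.card_univ, ← Finset.prod_const]
    refine Finset.prod_le_prod' fun a _ => ?_
    rw [Fintype.card_embedding_eq, Fintype.card_subtype, Fintype.card_subtype, hc a,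
      ← Nat.descFactorial_self]
    exact Nat.descFactorial_le _ (hcol a)
  refine hcard.trans ?_
  rw [← Nat.card_eq_fintype_card, ← Set.ncard_univ]
  refine Set.ncard_le_ncard_of_injOn (fun e x => (e (c x) ⟨x, rfl⟩).1) (fun e _ => ?_)
    (fun e _ e' _ h => ?_) (Set.toFinite _)
  · refine ⟨fun x y hxy => ?_, funext fun x => (e (c x) ⟨x, rfl⟩).2⟩
    have hcxy : c x = c y := by
      rw [← (e (c x) ⟨x, rfl⟩).2, ← (e (c y) ⟨y, rfl⟩).2]
      exact congrArg col hxy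
    have aux : ∀ a (hx : c x = a) (hy : c y = a),
        (e a ⟨x, hx⟩).1 = (e a ⟨y, hy⟩).1 → x = y := by
      intro a hx hy h
      exact congrArg Subtype.val ((e a).injective (Subtype.ext h))
    refine aux _ rfl hcxy.symm (hxy.trans ?_)
    have : ∀ a (hy : c y = a), (e (c y) ⟨y, rfl⟩).1 = (e a ⟨y, hy⟩).1 := by
      rintro a rfl; rfl
    exact this _ _
  · funext a
    ext ⟨x, rfl⟩
    exact congrFun h x

theorem card_mul_factorial_pow_le_card_injective {X V κ : Type*} [Fintype X] [DecidableEq X]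
    [Fintype V] [DecidableEq V] [Fintype κ] [DecidableEq κ] (col : V → κ) (m : ℕ)
    (hcol : ∀ a, m ≤ ({v | col v = a} : Finset V).card) (C : Finset (X → κ))
    (hc : ∀ c ∈ C, ∀ a, ({x | c x = a} : Finset X).card = m) :
    C.card * m.factorial ^ Fintype.card κ ≤
      Set.ncard {f : X → V | Function.Injective f ∧ col ∘ f ∈ C} := by
  classical
  rw [Set.ncard_eq_toFinset_card', ← smul_eq_mul]
  rw [Finset.card_eq_sum_card_fiberwise (f := fun f : X → V => col ∘ f) (t := C)
    (fun f hf => by simpa using (Set.mem_toFinset.1 hf).2)]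
  refine Finset.card_nsmul_le_sum _ _ _ fun c hcC => ?_
  refine (factorial_pow_le_card_injective col m hcol c (hc c hcC)).trans ?_
  rw [← Set.ncard_coe_finset]
  refine Set.ncard_le_ncard (fun f hf => ?_) (Set.toFinite _)
  simp only [Finset.coe_filter, Set.mem_toFinset, Set.mem_ofPred_eq]
  exact ⟨⟨hf.1, by rw [hf.2]; exact hcC⟩, hf.2⟩

/-- There are at least `(k - 1) ^ l` words of length `l + 1` over `ZMod k` starting with `0` in
which consecutive letters differ. -/
theorem pow_le_card_words (k l : ℕ) [NeZero k] :
    (k - 1) ^ l ≤ ({u | u 0 = 0 ∧ ∀ i : Fin l, u i.castSucc ≠ u i.succ} :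
      Finset (Fin (l + 1) → ZMod k)).card := by
  have h1 : (k - 1) ^ l = Fintype.card (Fin l → {a : ZMod k // a ≠ 0}) := by
    simp [Fintype.card_subtype_compl]
  rw [h1, ← Finset.card_univ]
  refine Finset.card_le_card_of_injOn (fun d => Fin.partialSum fun i => (d i).1)
    (fun d _ => ?_) (fun d _ d' _ h => ?_)
  · simp only [Finset.coe_filter, Finset.mem_univ, true_and, Set.mem_ofPred_eq,
      Fin.partialSum_zero, Fin.partialSum_succ, true_and]
    intro i h
    exact (d i).2 (by simpa using h)
  · funext i
    have h2 := congrFun h i.succ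
    have h3 := congrFun h i.castSucc
    simp only [Fin.partialSum_succ] at h2 h3
    rw [h3] at h2
    exact Subtype.ext (add_left_cancel h2)

/-- Concatenation of words: the word in block `j` is shifted by `j`, and reversed if `j` is odd. -/
def blockColouring {k L : ℕ} {m : ℕ} (w : Fin m → Fin L → ZMod k) : Fin m × Fin L → ZMod k :=
  fun x => w x.1 (if Even x.1.val then x.2 else x.2.rev) + (x.1.val : ZMod k)

theorem blockColouring_injective {k L m : ℕ} :
    Function.Injective (blockColouring : (Fin m → Fin L → ZMod k) → _) := by
  intro w w' h
  funext j i
  have h1 := congrFun h (j, if Even j.val then i else i.rev)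
  simp only [blockColouring, add_left_inj] at h1
  split_ifs at h1 <;> simpa using h1

theorem blockColouring_ne_of_same_block {k l m : ℕ} {w : Fin m → Fin (l + 1) → ZMod k}
    (hw : ∀ j, ∀ i : Fin l, w j i.castSucc ≠ w j i.succ) (j : Fin m) (i : Fin l) :
    blockColouring w (j, i.castSucc) ≠ blockColouring w (j, i.succ) := by
  simp only [blockColouring, ne_eq, add_left_inj]
  split_ifs
  · exact hw j i
  · rw [Fin.rev_castSucc, Fin.rev_succ]
    exact (hw j i.rev).symm

/-- Reversal makes equal letters meet at each joint (`b` with `b`, or `0` with `0`); the extra shift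
by `1` separates them. -/
theorem blockColouring_ne_of_next_block {k l m : ℕ} (hk : 2 ≤ k)
    {w : Fin m → Fin (l + 1) → ZMod k} {b : ZMod k}
    (h0 : ∀ j, w j 0 = 0) (hb : ∀ j, w j (Fin.last l) = b) {j j' : Fin m}
    (hpar : Even j'.val ↔ ¬ Even j.val) (hj : (j'.val : ZMod k) = j.val + 1) :
    blockColouring w (j, Fin.last l) ≠ blockColouring w (j', 0) := by
  have : Fact (1 < k) := ⟨hk⟩
  simp only [blockColouring, hj, hpar]
  by_cases h : Even j.val
  · simp [h, hb]
  · simp [h, h0]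

theorem sum_fin_two_mul_natCast {k : ℕ} [NeZero k] (g : ZMod k → ℕ) :
    ∑ j : Fin (2 * k), g (j.val : ZMod k) = 2 * ∑ b, g b := by
  rw [← finProdFinEquiv.sum_comp, Fintype.sum_prod_type]
  have h : ∑ y : Fin k, g (y.val : ZMod k) = ∑ b, g b := by
    refine Fintype.sum_bijective (fun y : Fin k => (y.val : ZMod k)) ⟨fun a b hab => ?_, fun b => ?_⟩
      _ _ fun _ => rfl
    · have := congrArg ZMod.val hab
      simp only [ZMod.val_natCast, Nat.mod_eq_of_lt a.2, Nat.mod_eq_of_lt b.2] at this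
      exact Fin.ext this
    · exact ⟨⟨b.val, ZMod.val_lt b⟩, by simp⟩
  simp [finProdFinEquiv, h]

/-- If all words have the same letter counts then their block colouring is balanced. -/
theorem card_blockColouring_eq {k L : ℕ} [NeZero k] {w : Fin (2 * k) → Fin L → ZMod k}
    {t : ZMod k → ℕ} (ht : ∀ j b, ({i | w j i = b} : Finset (Fin L)).card = t b) (a : ZMod k) :
    ({x | blockColouring w x = a} : Finset (Fin (2 * k) × Fin L)).card = 2 * L := by
  have hrow : ∀ j : Fin (2 * k), ({i | blockColouring w (j, i) = a} : Finset (Fin L)).card =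
      t (a - (j.val : ZMod k)) := by
    intro j
    rw [← ht j]
    -- Reversal keeps letter counts and the shift translates them; `2k` shifts then meet every
    -- residue twice.
    refine Finset.card_equiv (if Even j.val then Equiv.refl _ else Fin.revPerm) fun i => ?_
    simp only [blockColouring, Finset.mem_filter, Finset.mem_univ, true_and, eq_sub_iff_add_eq]
    split_ifs <;> simp
  have hsum : ∑ b, t b = L := by
    have h := Finset.card_eq_sum_card_fiberwise (f := w 0) (s := Finset.univ) (t := Finset.univ)
      (fun _ _ => Finset.mem_coe.2 (Finset.mem_univ _))
    rw [Finset.card_univ, Fintype.card_fin] at h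
    rw [h]
    exact Finset.sum_congr rfl fun b _ => (ht 0 b).symm
  rw [Finset.card_filter, Fintype.sum_prod_type]
  simp_rw [← Finset.card_filter, hrow]
  rw [sum_fin_two_mul_natCast (fun b => t (a - b)),
    show ∑ b, t (a - b) = ∑ b, t b from (Equiv.subLeft a).sum_comp t, hsum]

/-- Pigeonhole: many words share their letter counts and their last letter. -/
theorem exists_many_words (k l : ℕ) [NeZero k] :
    ∃ (P : Finset (Fin (l + 1) → ZMod k)) (t : ZMod k → ℕ) (b : ZMod k),
      (∀ u ∈ P, u 0 = 0 ∧ (∀ i : Fin l, u i.castSucc ≠ u i.succ) ∧ u (Fin.last l) = b ∧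
        ∀ a, ({i | u i = a} : Finset (Fin (l + 1))).card = t a) ∧
      (((k - 1 : ℕ) : ℝ) ^ l / ((l + 2 : ℕ) ^ k * k) ≤ P.card) := by
  classical
  set S := ({u | u 0 = 0 ∧ ∀ i : Fin l, u i.castSucc ≠ u i.succ} :
      Finset (Fin (l + 1) → ZMod k)) with hS
  have hkpos : (0 : ℝ) < k := by exact_mod_cast Nat.pos_of_ne_zero (NeZero.ne k)
  -- Each of the `k` letter counts has `l + 2` possible values and the last letter has `k`.
  let F : (Fin (l + 1) → ZMod k) → (ZMod k → Fin (l + 2)) × ZMod k := fun u =>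
    (fun a => ⟨({i | u i = a} : Finset (Fin (l + 1))).card,
      Nat.lt_succ_of_le ((Finset.card_le_univ _).trans (by simp))⟩, u (Fin.last l))
  obtain ⟨⟨t, b⟩, -, h⟩ := Finset.exists_le_card_fiber_of_nsmul_le_card_of_maps_to
    (s := S) (t := Finset.univ) (f := F) (b := ((k - 1 : ℕ) : ℝ) ^ l / ((l + 2 : ℕ) ^ k * k))
    (fun _ _ => Finset.mem_univ _) Finset.univ_nonempty (by
      have hc : (Finset.univ : Finset ((ZMod k → Fin (l + 2)) × ZMod k)).card = (l + 2) ^ k * k := by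
        simp [ZMod.card]
      rw [hc, nsmul_eq_mul]
      push_cast
      rw [mul_div_cancel₀ _ (by positivity)]
      exact_mod_cast pow_le_card_words k l)
  refine ⟨_, fun a => (t a).val, b, fun u hu => ?_, h⟩
  simp only [Finset.mem_filter, hS, Finset.mem_univ, true_and, F, Prod.mk.injEq] at hu
  refine ⟨hu.1.1, hu.1.2, hu.2.2, fun a => ?_⟩
  rw [← hu.2.1]

/-- How `Fin` splits into consecutive blocks under the successor map. -/
theorem exists_equiv_blocks {m l n : ℕ} (h : m * (l + 1) = n + 3) (hm : Even m) :
    ∃ e : Fin (n + 3) ≃ Fin m × Fin (l + 1), ∀ a,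
      (∃ j, ∃ i : Fin l, e a = (j, i.castSucc) ∧ e (a + 1) = (j, i.succ)) ∨
      ∃ j j', e a = (j, Fin.last l) ∧ e (a + 1) = (j', 0) ∧ (Even j'.val ↔ ¬ Even j.val) ∧
        (j'.val = j.val + 1 ∨ j'.val = 0 ∧ j.val + 1 = m) := by
  refine ⟨(finCongr h.symm).trans finProdFinEquiv.symm, fun a => ?_⟩
  have hval : ∀ a : Fin (n + 3), ((finCongr h.symm).trans finProdFinEquiv.symm) a =
      (⟨a.val / (l + 1), Nat.div_lt_of_lt_mul (by rw [mul_comm, h]; exact a.2)⟩,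
        ⟨a.val % (l + 1), Nat.mod_lt _ (Nat.succ_pos _)⟩) := fun _ => rfl
  have ha := Nat.div_add_mod a.val (l + 1)
  have hlt := Nat.mod_lt a.val (Nat.succ_pos l)
  set q := a.val / (l + 1) with hq
  set r := a.val % (l + 1) with hr
  have hqm : q < m := Nat.div_lt_of_lt_mul (by rw [mul_comm, h]; exact a.2)
  have hsucc : (a + 1).val = (a.val + 1) % (n + 3) := by
    rw [Fin.val_add]; simp
  rcases (by omega : r < l ∨ r = l) with hrl | hrl
  · left
    have hle : q + 1 ≤ m := hqm
    have h1 : a.val + 1 < n + 3 := by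
      have : (l + 1) * (q + 1) ≤ (l + 1) * m := Nat.mul_le_mul_left _ hle
      rw [mul_comm _ m, h] at this
      have h2 : (l + 1) * (q + 1) = (l + 1) * q + (l + 1) := by ring
      omega
    rw [Nat.mod_eq_of_lt h1] at hsucc
    have hd : (a + 1).val / (l + 1) = q := by
      rw [hsucc, ← ha, add_assoc, Nat.mul_add_div (Nat.succ_pos l),
        Nat.div_eq_of_lt (by omega), add_zero]
    have hmod : (a + 1).val % (l + 1) = r + 1 := by
      rw [hsucc, ← ha, add_assoc, Nat.mul_add_mod, Nat.mod_eq_of_lt (by omega)]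
    refine ⟨⟨q, hqm⟩, ⟨r, hrl⟩, ?_, ?_⟩
    · rw [hval]; rfl
    · rw [hval]
      exact Prod.ext (Fin.ext hd) (Fin.ext hmod)
  · right
    have ha1 : a.val + 1 = (l + 1) * (q + 1) := by
      rw [← ha, hrl]; ring
    rcases (by omega : q + 1 < m ∨ q + 1 = m) with hqm' | hqm'
    · have h1 : a.val + 1 < n + 3 := by
        rw [ha1]
        refine lt_of_lt_of_eq ?_ h
        rw [mul_comm]
        exact Nat.mul_lt_mul_of_pos_right hqm' (Nat.succ_pos l)
      rw [Nat.mod_eq_of_lt h1, ha1] at hsucc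
      refine ⟨⟨q, hqm⟩, ⟨q + 1, hqm'⟩, ?_, ?_, by simp [Nat.even_add_one], Or.inl rfl⟩
      · rw [hval]
        exact Prod.ext (Fin.ext rfl) (Fin.ext hrl)
      · rw [hval]
        refine Prod.ext (Fin.ext ?_) (Fin.ext ?_)
        · simp only [hsucc]; rw [Nat.mul_div_cancel_left _ (Nat.succ_pos l)]
        · simp only [hsucc]; rw [Nat.mul_mod_right]; rfl
    · have h1 : a.val + 1 = n + 3 := by rw [ha1, hqm', mul_comm, h]
      rw [h1, Nat.mod_self] at hsucc
      refine ⟨⟨q, hqm⟩, ⟨0, by lia⟩, ?_, ?_, ?_, Or.inr ⟨rfl, hqm'⟩⟩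
      · rw [hval]
        exact Prod.ext (Fin.ext rfl) (Fin.ext hrl)
      · rw [hval]
        refine Prod.ext (Fin.ext ?_) (Fin.ext ?_)
        · simp only [hsucc]; exact Nat.zero_div _
        · simp only [hsucc]; exact Nat.zero_mod _
      -- At the wrap-around, evenness of `m` makes the last block odd, opposite in parity to block
      -- `0`.
      · rw [← hqm'] at hm
        simpa [Nat.even_add_one] using hm

/-! ### Many cycles in the Turán graph -/

namespace SimpleGraph

/-- A lower bound for the number of cycles of a Turán graph. -/
theorem le_cycleCount_turanGraph {k l n : ℕ} (hk : 2 ≤ k) (hn : 2 * k * (l + 1) ≤ n) :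
    (((k - 1 : ℕ) : ℝ) ^ l / ((l + 2 : ℕ) ^ k * k)) ^ (2 * k) *
        ((2 * (l + 1)).factorial : ℝ) ^ k ≤
      (turanGraph n k).cycleCount * (n : ℝ) ^ 2 := by
  classical
  have : NeZero k := ⟨by omega⟩
  obtain ⟨P, t, b, hP, hPcard⟩ := exists_many_words k l
  obtain ⟨n', hn'⟩ : ∃ n', 2 * k * (l + 1) = n' + 3 := by
    have : 4 * 1 ≤ 2 * k * (l + 1) := Nat.mul_le_mul (by omega) (by omega)
    exact ⟨2 * k * (l + 1) - 3, by omega⟩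
  obtain ⟨e, he⟩ := exists_equiv_blocks hn' (even_two_mul k)
  set C : Finset (Fin (2 * k) × Fin (l + 1) → ZMod k) :=
    (Fintype.piFinset fun _ : Fin (2 * k) => P).image blockColouring with hC
  have hCcard : C.card = P.card ^ (2 * k) := by
    rw [hC, Finset.card_image_of_injective _ blockColouring_injective, Fintype.card_piFinset_const]
  have hbal : ∀ c ∈ C, ∀ a, ({x | c x = a} : Finset (Fin (2 * k) × Fin (l + 1))).card =
      2 * (l + 1) := by
    intro c hc a
    obtain ⟨w, hw, rfl⟩ := Finset.mem_image.1 hc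
    rw [Fintype.mem_piFinset] at hw
    exact card_blockColouring_eq (fun j b => (hP _ (hw j)).2.2.2 b) a
  have hproper : ∀ c ∈ C, ∀ a, c (e a) ≠ c (e (a + 1)) := by
    intro c hc a
    obtain ⟨w, hw, rfl⟩ := Finset.mem_image.1 hc
    rw [Fintype.mem_piFinset] at hw
    rcases he a with ⟨j, i, h1, h2⟩ | ⟨j, j', h1, h2, hpar, hj⟩
    · rw [h1, h2]
      exact blockColouring_ne_of_same_block (fun j => (hP _ (hw j)).2.1) j i
    · rw [h1, h2]
      refine blockColouring_ne_of_next_block hk (fun j => (hP _ (hw j)).1)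
        (fun j => (hP _ (hw j)).2.2.1) hpar ?_
      -- The shifts close up cyclically because the number of blocks, `2k`, vanishes modulo `k`.
      rcases hj with hj | ⟨hj, hj'⟩
      · rw [hj]; push_cast; rfl
      · rw [hj, ← Nat.cast_add_one, hj']; simp
  let col : Fin n → ZMod k := fun v => (v.val : ZMod k)
  have hcol : ∀ a, 2 * (l + 1) ≤ ({v | col v = a} : Finset (Fin n)).card := by
    intro a
    have hlt : ∀ i : Fin (2 * (l + 1)), k * i.val + a.val < n := by
      intro i
      have h1 : k * (i.val + 1) ≤ k * (2 * (l + 1)) := Nat.mul_le_mul_left _ i.2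
      have h2 := ZMod.val_lt a
      have h3 : k * (2 * (l + 1)) = 2 * k * (l + 1) := by ring
      have h4 : k * (i.val + 1) = k * i.val + k := by ring
      omega
    rw [← Fintype.card_fin (2 * (l + 1)), ← Finset.card_univ]
    refine Finset.card_le_card_of_injOn (fun i => ⟨k * i.val + a.val, hlt i⟩) (fun i _ => ?_)
      (fun i _ j _ h => ?_)
    · simp [col]
    · simp only [Fin.mk.injEq, add_left_inj] at h
      exact Fin.ext (Nat.eq_of_mul_eq_mul_left (by omega) h)
  have hcount := card_mul_factorial_pow_le_card_injective col _ hcol C hbal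
  have hle : Set.ncard {f : Fin (2 * k) × Fin (l + 1) → Fin n |
      Function.Injective f ∧ col ∘ f ∈ C} ≤ (turanGraph n k).cycleCount * n ^ 2 := by
    have h := card_cyclic_le_cycleCount_mul (turanGraph n k)
      (({f | Function.Injective f ∧ col ∘ f ∈ C} : Finset (_ → Fin n)).image fun f => f ∘ e)
      (fun f hf => by
        obtain ⟨g, hg, rfl⟩ := Finset.mem_image.1 hf
        exact (Finset.mem_filter.1 hg).2.1.comp e.injective)
      (fun f hf i => by
        obtain ⟨g, hg, rfl⟩ := Finset.mem_image.1 hf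
        have h1 := hproper _ (Finset.mem_filter.1 hg).2.2 i
        rw [turanGraph_adj]
        intro h2
        exact h1 ((ZMod.natCast_eq_natCast_iff' _ _ _).2 h2))
    rw [Finset.card_image_of_injective _ e.surjective.injective_comp_right, Fintype.card_fin] at h
    rw [Set.ncard_eq_toFinset_card']
    convert h using 2
    ext; simp
  rw [hCcard, ZMod.card] at hcount
  calc _ ≤ (P.card : ℝ) ^ (2 * k) * ((2 * (l + 1)).factorial : ℝ) ^ k := by gcongr
    _ ≤ _ := by exact_mod_cast hcount.trans hle

end SimpleGraph

/-! ### Factorial estimates -/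

theorem Real.log_factorial_le {x : ℕ} (hx : 1 ≤ x) :
    Real.log x.factorial ≤ x * Real.log x - x + 1 + Real.log x := by
  induction x, hx using Nat.le_induction with
  | base => simp
  | succ x hx ih =>
    have hx0 : (0 : ℝ) < x := by exact_mod_cast hx
    rw [Nat.factorial_succ, Nat.cast_mul, Real.log_mul (by positivity) (by positivity)]
    have h := Real.log_le_sub_one_of_pos (show (0 : ℝ) < x / (x + 1) by positivity)
    rw [Real.log_div hx0.ne' (by positivity)] at h
    have h2 : (x / (x + 1) - 1 : ℝ) * (x + 1) = -1 := by field_simp; ring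
    push_cast
    nlinarith

theorem Real.le_log_factorial {x : ℕ} (hx : 1 ≤ x) :
    x * Real.log x - x ≤ Real.log x.factorial := by
  have h := Stirling.le_log_factorial_stirling (n := x) (by omega)
  have h1 : 0 ≤ Real.log x := Real.log_natCast_nonneg x
  have h2 : 0 ≤ Real.log (2 * Real.pi) := Real.log_nonneg (by linarith [Real.pi_gt_three])
  linarith

/-- A tangent line bound for `log (x!) / x`. -/
theorem Real.log_factorial_div_le {x n : ℕ} {D : ℝ} (hx : 1 ≤ x) (hxn : x ≤ n)
    (hD : (n : ℝ) / 2 ≤ D) :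
    Real.log x.factorial / x ≤ Real.log D - 2 + x / D + 20 * (1 + Real.log n) / n := by
  have hx0 : (0 : ℝ) < x := by exact_mod_cast hx
  have hx1 : (1 : ℝ) ≤ x := by exact_mod_cast hx
  have hxn' : (x : ℝ) ≤ n := by exact_mod_cast hxn
  have hn0 : (0 : ℝ) < n := by linarith
  have hD0 : 0 < D := by linarith
  have hlogn : 0 ≤ Real.log n := Real.log_natCast_nonneg n
  have h1 : Real.log x.factorial / x ≤ Real.log x - 1 + (1 + Real.log x) / x := by
    rw [div_le_iff₀ hx0, add_mul, div_mul_cancel₀ _ hx0.ne']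
    linarith [Real.log_factorial_le hx]
  refine h1.trans ?_
  have hlogdiv : Real.log (x / D) = Real.log x - Real.log D := Real.log_div hx0.ne' hD0.ne'
  -- For `x ≥ D / 10 ≥ n / 20` the Stirling error is `O(log n / n)`. For smaller `x` that error is
  -- at most `1`, which `log (x / D) ≤ -2` absorbs, as `e ^ 2 ≤ 10`.
  by_cases hc : D / 10 ≤ x
  · have h2 := Real.log_le_sub_one_of_pos (div_pos hx0 hD0)
    have h3 : (1 + Real.log x) / x ≤ 20 * (1 + Real.log n) / n := by
      rw [div_le_div_iff₀ hx0 hn0]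
      have h4 : Real.log x ≤ Real.log n := Real.log_le_log hx0 hxn'
      have h5 : (n : ℝ) ≤ 20 * x := by linarith
      have h6 : 0 ≤ Real.log x := Real.log_natCast_nonneg x
      calc (1 + Real.log x) * n ≤ (1 + Real.log n) * (20 * x) := by gcongr
        _ = _ := by ring
    linarith
  · push Not at hc
    have h2 : (1 + Real.log x) / x ≤ 1 := by
      rw [div_le_one hx0]
      linarith [Real.log_le_sub_one_of_pos hx0]
    have h3 : Real.log (x / D) ≤ -2 := by
      rw [Real.log_le_iff_le_exp (div_pos hx0 hD0), Real.exp_neg, le_inv_comm₀ (div_pos hx0 hD0)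
        (Real.exp_pos _), inv_div, le_div_iff₀ hx0]
      have h4 : Real.exp 2 ≤ 10 := by
        have h5 := Real.exp_one_lt_d9
        have h6 : Real.exp 2 = Real.exp 1 * Real.exp 1 := by rw [← Real.exp_add]; norm_num
        rw [h6]
        nlinarith [Real.exp_pos 1]
      nlinarith
    have h4 : 0 ≤ 20 * (1 + Real.log n) / n := by positivity
    have h5 : 0 ≤ x / D := by positivity
    linarith

/-! ### Logarithmic bounds and their comparison -/

namespace SimpleGraph

/-- An upper bound for the number of cycles in terms of the number of edges. -/
theorem log_cycleCount_le_of_card {V : Type*} [Fintype V] (G : SimpleGraph V) {n : ℕ}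
    (hn : Fintype.card V = n) (hn0 : 0 < n) {D : ℝ} (hD : (n : ℝ) / 2 ≤ D) :
    Real.log G.cycleCount ≤
      n * Real.log D - 2 * n + (2 * (G.edgeSet.ncard : ℝ) + n) / D + 20 * (1 + Real.log n) := by
  classical
  have hn0' : (0 : ℝ) < n := by exact_mod_cast hn0
  refine G.log_cycleCount_le.trans ?_
  refine (Finset.sum_le_sum fun v _ => Real.log_factorial_div_le (n := n) (D := D)
    (by omega) (hn ▸ G.degree_lt_card_verts v) hD).trans (le_of_eq ?_)
  have hdeg : ∑ v, ((G.degree v + 1 : ℕ) : ℝ) = 2 * (G.edgeSet.ncard : ℝ) + n := by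
    rw [← Nat.cast_sum, Finset.sum_add_distrib, G.sum_degrees_eq_twice_card_edges,
      ← coe_edgeFinset, Set.ncard_coe_finset]
    simp [hn]
  rw [Finset.sum_add_distrib, Finset.sum_add_distrib, ← Finset.sum_div, hdeg]
  simp only [Finset.sum_const, Finset.card_univ, hn, nsmul_eq_mul]
  field_simp

/-- With blocks of length `⌊n / (2k)⌋` the constructed cycles miss fewer than `2k` vertices. The
words contribute about `n log (k - 1)` and the factorials about `n log (n / k) - n`. -/
theorem le_log_cycleCount_turanGraph {k n : ℕ} (hk : 2 ≤ k) (hn : 2 * k ≤ n) :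
    0 < (turanGraph n k).cycleCount ∧
    n * Real.log ((k - 1 : ℝ) * n / k) - n - (2 * k ^ 2 + 6 * k + 2) * Real.log n - 2 * k ≤
      Real.log (turanGraph n k).cycleCount := by
  have hL1 : 1 ≤ n / (2 * k) := (Nat.one_le_div_iff (by omega)).2 hn
  obtain ⟨l, hl⟩ : ∃ l, n / (2 * k) = l + 1 := ⟨n / (2 * k) - 1, by omega⟩
  have hdm := Nat.div_add_mod n (2 * k)
  have hmod := Nat.mod_lt n (show 0 < 2 * k by omega)
  rw [hl] at hdm
  have h := le_cycleCount_turanGraph hk (show 2 * k * (l + 1) ≤ n by omega)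
  have hkr : (2 : ℝ) ≤ k := by exact_mod_cast hk
  have hnr : 2 * (k : ℝ) ≤ n := by exact_mod_cast hn
  have hn0 : (0 : ℝ) < n := by linarith
  have hk1 : ((k - 1 : ℕ) : ℝ) = k - 1 := by rw [Nat.cast_sub (by omega)]; simp
  have hk1pos : (0 : ℝ) < k - 1 := by linarith
  rw [hk1] at h
  have hfac : (0 : ℝ) < (2 * (l + 1)).factorial := by exact_mod_cast Nat.factorial_pos _
  have hlhs : 0 < ((k - 1 : ℝ) ^ l / ((l + 2 : ℕ) ^ k * k)) ^ (2 * k) *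
      ((2 * (l + 1)).factorial : ℝ) ^ k := by positivity
  have hpos : (0 : ℝ) < (turanGraph n k).cycleCount :=
    pos_of_mul_pos_left (hlhs.trans_le h) (by positivity)
  refine ⟨by exact_mod_cast hpos, ?_⟩
  have hlog := Real.log_le_log hlhs h
  rw [Real.log_mul (by positivity) (by positivity), Real.log_pow, Real.log_pow,
    Real.log_div (by positivity) (by positivity), Real.log_mul (by positivity) (by positivity),
    Real.log_pow, Real.log_pow, Real.log_mul hpos.ne' (by positivity), Real.log_pow] at hlog
  have hst := Real.le_log_factorial (x := 2 * (l + 1)) (by omega)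
  set F := Real.log ((2 * (l + 1)).factorial : ℝ)
  set N : ℝ := 2 * k * (l + 1) with hN
  have hN0 : 0 < N := by positivity
  have hNn : N ≤ n := by
    have : 2 * k * (l + 1) ≤ n := by omega
    rw [hN]; exact_mod_cast this
  have hNn' : n ≤ N + 2 * k := by
    have : n ≤ 2 * k * (l + 1) + 2 * k := by omega
    rw [hN]; exact_mod_cast this
  have hlogn : 0 ≤ Real.log n := Real.log_natCast_nonneg n
  have hlogk : Real.log k ≤ Real.log n := Real.log_le_log (by linarith) (by linarith)
  have hlogk1 : Real.log (k - 1 : ℝ) ≤ Real.log n := Real.log_le_log hk1pos (by linarith)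
  have hlogl : Real.log ((l + 2 : ℕ) : ℝ) ≤ Real.log n := by
    refine Real.log_le_log (by positivity) ?_
    have h1 : 4 * (l + 1) ≤ 2 * k * (l + 1) := Nat.mul_le_mul_right _ (by omega)
    exact_mod_cast (by omega : l + 2 ≤ n)
  have hm : Real.log ((2 * (l + 1) : ℕ) : ℝ) = Real.log N - Real.log k := by
    rw [← Real.log_div hN0.ne' (by positivity)]
    congr 1
    rw [hN]; push_cast; field_simp
  rw [hm] at hst
  have hD : Real.log ((k - 1 : ℝ) * n / k) = Real.log (k - 1 : ℝ) + Real.log n - Real.log k := by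
    rw [Real.log_div (by positivity) (by positivity), Real.log_mul hk1pos.ne' hn0.ne']
  have hDle : Real.log ((k - 1 : ℝ) * n / k) ≤ Real.log n := by
    refine Real.log_le_log (by positivity) ?_
    rw [div_le_iff₀ (by positivity)]
    nlinarith
  have hratio : N * (Real.log n - Real.log N) ≤ n - N := by
    have h1 := Real.log_le_sub_one_of_pos (div_pos hn0 hN0)
    rw [Real.log_div hn0.ne' hN0.ne'] at h1
    calc N * (Real.log n - Real.log N) ≤ N * (n / N - 1) := by gcongr
      _ = n - N := by field_simp
  have hkst : N * (Real.log N - Real.log k) - N ≤ k * F := by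
    have h1 : k * (((2 * (l + 1) : ℕ) : ℝ) * (Real.log N - Real.log k) - ((2 * (l + 1) : ℕ) : ℝ)) ≤
      k * F := by gcongr
    refine le_trans (le_of_eq ?_) h1
    rw [hN]; push_cast; ring
  have e1 : (2 * k : ℝ) * (k * Real.log ((l + 2 : ℕ) : ℝ)) ≤ 2 * k ^ 2 * Real.log n := by
    calc (2 * k : ℝ) * (k * Real.log ((l + 2 : ℕ) : ℝ)) ≤ (2 * k : ℝ) * (k * Real.log n) := by gcongr
      _ = _ := by ring
  have e2 : (2 * k : ℝ) * Real.log k ≤ 2 * k * Real.log n := by gcongr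
  have e3 : (2 * k : ℝ) * Real.log (k - 1 : ℝ) ≤ 2 * k * Real.log n := by gcongr
  have e4 : (n - N) * Real.log ((k - 1 : ℝ) * n / k) ≤ 2 * k * Real.log n := by
    calc (n - N) * Real.log ((k - 1 : ℝ) * n / k) ≤ (n - N) * Real.log n :=
          mul_le_mul_of_nonneg_left hDle (by linarith)
      _ ≤ 2 * k * Real.log n := mul_le_mul_of_nonneg_right (by linarith) hlogn
  have e5 : N * Real.log ((k - 1 : ℝ) * n / k) =
      N * Real.log (k - 1 : ℝ) + N * (Real.log n - Real.log N) + N * (Real.log N - Real.log k) := by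
    rw [hD]; ring
  have e6 : (2 * k : ℝ) * (l * Real.log (k - 1 : ℝ)) =
      N * Real.log (k - 1 : ℝ) - 2 * k * Real.log (k - 1 : ℝ) := by
    rw [hN]; ring
  push_cast at hlog e1 e2
  nlinarith

end SimpleGraph

theorem lemma4p1 {W : Type*} [Fintype W] (H : SimpleGraph W) (k : ℕ) (hk : 2 ≤ k)
    (hχ : H.chromaticNumber = (k : ℕ∞) + 1) (hcrit : ∃ e : Sym2 W, H.IsCriticalEdge e) :
    ∃ (C : ℝ) (n₀ : ℕ), ∀ n : ℕ, n₀ ≤ n →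
      ∀ (V : Type*) [Fintype V] (G : SimpleGraph V), Fintype.card V = n → H.Free G →
        (SimpleGraph.turanGraph n k).cycleCount ≤ G.cycleCount →
        ((k : ℝ) - 1) * (n : ℝ) ^ 2 / (2 * (k : ℝ)) - C * ((n : ℝ) * Real.log (n : ℝ) ^ 2)
          ≤ (G.edgeSet.ncard : ℝ) := by
  -- The constant is the sum of the coefficients on the right of `h2`, so `h2` becomes `2 C ℓ² ≤ C
  -- ℓ` once `ℓ ≥ 1`. The threshold leaves room for nonempty blocks and gives `n ≥ 4 > e`.
  refine ⟨2 * k ^ 2 + 8 * k + 44, 2 * k, fun n hn V _ G hV _ hc => ?_⟩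
  have hkr : (2 : ℝ) ≤ k := by exact_mod_cast hk
  have hnr : 2 * (k : ℝ) ≤ n := by exact_mod_cast hn
  have hn0 : (0 : ℝ) < n := by linarith
  obtain ⟨hpos, hlow⟩ := SimpleGraph.le_log_cycleCount_turanGraph hk hn
  set D : ℝ := (k - 1 : ℝ) * n / k with hD
  have hDn : (n : ℝ) / 2 ≤ D := by
    rw [hD, div_le_div_iff₀ (by norm_num) (by positivity)]
    nlinarith
  have hDn' : D ≤ n := by
    rw [hD, div_le_iff₀ (by positivity)]
    nlinarith
  have hD0 : 0 < D := by linarith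
  have hup := G.log_cycleCount_le_of_card hV (by omega) hDn
  have hmono : Real.log (SimpleGraph.turanGraph n k).cycleCount ≤ Real.log G.cycleCount :=
    Real.log_le_log (by exact_mod_cast hpos) (by exact_mod_cast hc)
  have hlog1 : 1 ≤ Real.log n := by
    rw [Real.le_log_iff_exp_le hn0]
    linarith [Real.exp_one_lt_d9]
  by_contra! hlt
  set ℓ := Real.log n
  set E : ℝ := (G.edgeSet.ncard : ℝ)
  set C : ℝ := 2 * k ^ 2 + 8 * k + 44 with hC
  have hC0 : 0 < C := by positivity
  have hnD : (k - 1 : ℝ) * n ^ 2 / (2 * k) = n * D / 2 := by rw [hD]; field_simp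
  rw [hnD] at hlt
  -- `D ≤ n` controls the deficit term, and `n / 2 ≤ D` gives the final `2`.
  have hfrac : (2 * E + n) / D ≤ n - 2 * C * ℓ ^ 2 + 2 := by
    rw [div_le_iff₀ hD0]
    have h1 : 2 * C * ℓ ^ 2 * D ≤ 2 * C * ℓ ^ 2 * n := by gcongr
    nlinarith
  have hsq : ℓ ≤ ℓ ^ 2 := by nlinarith
  have h2 : 2 * C * ℓ ^ 2 ≤ 22 + 2 * k + (2 * k ^ 2 + 6 * k + 22) * ℓ := by linarith
  have h3 : 22 + 2 * k ≤ (22 + 2 * k : ℝ) * ℓ := le_mul_of_one_le_right (by positivity) hlog1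
  have h4 : C * ℓ ≤ C * ℓ ^ 2 := by gcongr
  have h5 : 0 < C * ℓ ^ 2 := by positivity
  rw [hC] at h2 h4 h5
  nlinarith
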